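/- Let $n\ge 3$ and let $r$ be an integer with $2<r<n$. Let $M^n\subset\mathbb{R}^{n+1}$ be a translation hypersurface, that is, the graph $\{(x,F(x)) : x\in\Omega\}$ over an open set $\Omega\subset\mathbb{R}^n$ of a function of the form $F(x_1,\ldots,x_n)=f_1(x_1)+\cdots+f_n(x_n)$, where each $f_i$ is a smooth function of one real variable, defined on the values that the coordinate $x_i$ takes on $\Omega$. Orient $M$ by a smooth unit normal field $N$, let $A=-dN$ be its shape operator, and let $S_r=\sum_{1\le i_1<\cdots<i_r\le n}\lambda_{i_1}\cdots\lambda_{i_r}$ be the $r$-th elementary symmetric function of the principal curvatures $\lambda_1,\ldots,\lambda_n$ (the eigenvalues of $A$ counted with multiplicity); equivalently, $\det(A-\lambda I)=\sum_{k=0}^{n}(-1)^{n-k}S_k\lambda^{n-k}$. If $S_r$ is constant on $M$, then $S_r=0$ on $M$. -/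

import Mathlib

open scoped ContDiff RealInnerProductSpace

noncomputable section

namespace TranslationHypersurface

/-- Euclidean space `ℝ^m`. -/
abbrev Euc (m : ℕ) : Type := EuclideanSpace ℝ (Fin m)

/-- The parametrization `x ↦ (x₁, …, xₙ, F x)` of the graph of `F`. -/
def graphMap {n : ℕ} (F : Euc n → ℝ) (x : Euc n) : Euc (n + 1) :=
  WithLp.toLp 2 (Fin.snoc (α := fun _ => ℝ) (fun i => x i) (F x))

/-- The function `F(x₁, …, xₙ) = f₁(x₁) + ⋯ + fₙ(xₙ)`. -/
def separableSum {n : ℕ} (f : Fin n → ℝ → ℝ) (x : Euc n) : ℝ :=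
  ∑ i, f i (x i)

/-- The graph of `x ↦ f₁(x₁) + ⋯ + fₙ(xₙ)` over `Ω` is a (smooth) translation hypersurface:
`Ω` is open in `ℝⁿ` and each `fᵢ` is smooth on the set of values of the `i`-th coordinate on
`Ω`. -/
structure IsTranslationGraph {n : ℕ} (Ω : Set (Euc n)) (f : Fin n → ℝ → ℝ) : Prop where
  isOpen : IsOpen Ω
  smooth : ∀ i, ContDiffOn ℝ ∞ (f i) ((fun x : Euc n => x i) '' Ω)

/-- `N` is a smooth unit normal vector field along `ψ : Ω → ℝⁿ⁺¹`, i.e. an orientation of the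
hypersurface parametrized by `ψ`. -/
structure IsUnitNormalField {n : ℕ} (Ω : Set (Euc n)) (ψ N : Euc n → Euc (n + 1)) : Prop where
  smooth : ContDiffOn ℝ ∞ N Ω
  norm_eq_one : ∀ x ∈ Ω, ‖N x‖ = 1
  normal : ∀ x ∈ Ω, ∀ v : Euc n, ⟪N x, fderiv ℝ ψ x v⟫ = 0

open Classical in
/-- The shape operator `A_x` at `x` of the hypersurface immersed by `ψ` and oriented by `N`.
The tangent space at `x` is identified with `ℝⁿ` through the injective differential `dψ_x`, and
`A_x` is the endomorphism characterized by `dψ_x (A_x v) = - dN_x v`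
(see `exists_unique_shape` and `shapeOperator_spec`). -/
def shapeOperator {n : ℕ} (ψ N : Euc n → Euc (n + 1)) (x : Euc n) : Euc n →ₗ[ℝ] Euc n :=
  if h : ∃ A : Euc n →ₗ[ℝ] Euc n, ∀ v, fderiv ℝ ψ x (A v) = -fderiv ℝ N x v then h.choose else 0

/-- The shape operator exists and is unique for an immersion oriented by a unit normal field. -/
theorem exists_unique_shape {n : ℕ} {Ω : Set (Euc n)} (hΩ : IsOpen Ω)
    {ψ N : Euc n → Euc (n + 1)} (hN : IsUnitNormalField Ω ψ N) {x : Euc n} (hx : x ∈ Ω)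
    (hinj : Function.Injective (fderiv ℝ ψ x)) :
    ∃! A : Euc n →ₗ[ℝ] Euc n, ∀ v, fderiv ℝ ψ x (A v) = -fderiv ℝ N x v := by
  set L : Euc n →ₗ[ℝ] Euc (n + 1) := (fderiv ℝ ψ x : Euc n →ₗ[ℝ] Euc (n + 1)) with hL
  have hNx : N x ≠ 0 := by
    intro h
    have := hN.norm_eq_one x hx
    simp [h] at this
  have hle : LinearMap.range L ≤ (ℝ ∙ N x)ᗮ := by
    rintro _ ⟨v, rfl⟩
    rw [Submodule.mem_orthogonal_singleton_iff_inner_right]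
    exact hN.normal x hx v
  have hrange : LinearMap.range L = (ℝ ∙ N x)ᗮ := by
    apply Submodule.eq_of_le_of_finrank_eq hle
    rw [LinearMap.finrank_range_of_inj hinj]
    have h1 := Submodule.finrank_add_finrank_orthogonal (ℝ ∙ N x)
    rw [finrank_span_singleton hNx] at h1
    simp only [finrank_euclideanSpace, Fintype.card_fin] at h1 ⊢
    omega
  have hdiff : DifferentiableAt ℝ N x :=
    (hN.smooth.contDiffAt (hΩ.mem_nhds hx)).differentiableAt (by simp)
  have horth : ∀ v, ⟪N x, fderiv ℝ N x v⟫ = 0 := by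
    intro v
    have h1 : HasFDerivAt (fun y => ⟪N y, N y⟫) _ x :=
      hdiff.hasFDerivAt.inner ℝ hdiff.hasFDerivAt
    have h2 : HasFDerivAt (fun y => ⟪N y, N y⟫) (0 : Euc n →L[ℝ] ℝ) x := by
      apply (hasFDerivAt_const (1 : ℝ) x).congr_of_eventuallyEq
      filter_upwards [hΩ.mem_nhds hx] with y hy
      rw [real_inner_self_eq_norm_sq, hN.norm_eq_one y hy, one_pow]
    have h3 := congrArg (fun T : Euc n →L[ℝ] ℝ => T v) (h1.unique h2)
    simp [real_inner_comm] at h3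
    rw [real_inner_comm] at h3
    simpa [real_inner_comm] using h3
  have hmem : ∀ v, -fderiv ℝ N x v ∈ LinearMap.range L := by
    intro v
    rw [hrange, Submodule.mem_orthogonal_singleton_iff_inner_right, inner_neg_right, horth, neg_zero]
  let e := LinearEquiv.ofInjective L hinj
  let D : Euc n →ₗ[ℝ] LinearMap.range L :=
    LinearMap.codRestrict _ (-(fderiv ℝ N x : Euc n →ₗ[ℝ] Euc (n + 1))) hmem
  refine ⟨e.symm.toLinearMap ∘ₗ D, fun v => ?_, fun B hB => ?_⟩
  · exact congrArg Subtype.val (e.apply_symm_apply (D v))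
  · ext1 v
    apply hinj
    rw [hB v]
    exact (congrArg Subtype.val (e.apply_symm_apply (D v))).symm

theorem shapeOperator_spec {n : ℕ} {Ω : Set (Euc n)} (hΩ : IsOpen Ω)
    {ψ N : Euc n → Euc (n + 1)} (hN : IsUnitNormalField Ω ψ N) {x : Euc n} (hx : x ∈ Ω)
    (hinj : Function.Injective (fderiv ℝ ψ x)) (v : Euc n) :
    fderiv ℝ ψ x (shapeOperator ψ N x v) = -fderiv ℝ N x v := by
  have h := (exists_unique_shape hΩ hN hx hinj).exists
  rw [shapeOperator, dif_pos h]
  exact h.choose_spec v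

/-- The curvature `S_r` at `x` (`0 ≤ r ≤ n`): the `r`-th elementary symmetric function of the
principal curvatures, i.e. of the eigenvalues of the shape operator `A`, read off from
`det (λ I - A) = ∑ₖ (-1)ᵏ Sₖ λⁿ⁻ᵏ`. -/
def Scurv {n : ℕ} (r : ℕ) (ψ N : Euc n → Euc (n + 1)) (x : Euc n) : ℝ :=
  (-1) ^ r * (shapeOperator ψ N x).charpoly.coeff (n - r)

end TranslationHypersurface

end

/-!
Write `W² = 1 + ∑ fᵢ'²`. The shape operator of a translation graph is, up to a scalar, a rank-one
perturbation of the identity times `diag (fᵢ'')`, so that the sum of its principal minors gives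
`S_r = ± W ^ (-(r + 2)) * ∑_{|s| = r} (∏_{i ∈ s} fᵢ'') * (1 + ∑_{j ∉ s} fⱼ'²)`.

Suppose that `S_r` is a constant `c ≠ 0`. The sum over `s` then equals `± c * W ^ (r + 2)` and does
not vanish, hence at least two of the `fᵢ''` are nonzero at each point, and `fᵢ'²`, `fⱼ'²` fill
intervals for these two indices. Along an `i`-th coordinate line the sum is affine in `fᵢ''` and
`y = fᵢ'²`, while `W ^ (r + 2) = (y + T) ^ ((r + 2) / 2)` with `T` constant on the line. Moving
`xⱼ` gives a parallel line with another value of `T`, and eliminating `fᵢ''` between the two lines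
leaves a combination of two translates of the power function that is affine in `y`. This is
impossible unless the exponent is `0`, `1` or `2`, whereas `(r + 2) / 2 > 2`.
-/

open Filter Topology Finset

namespace TranslationHypersurface

section CurvatureNumerator

variable {ι R : Type*} [Fintype ι] [DecidableEq ι]

/-- The numerator of the curvature `S_r` of a translation graph: for `aᵢ = fᵢ''` and `yᵢ = fᵢ'²`
it is `± W ^ (r + 2) * S_r`, where `W = √(1 + ∑ fᵢ'²)` is the area element. -/
def curvatureNumerator [CommSemiring R] (r : ℕ) (a y : ι → R) : R :=
  ∑ s ∈ univ.powersetCard r, (∏ i ∈ s, a i) * (1 + ∑ j ∈ sᶜ, y j)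

theorem exists_affine_curvatureNumerator_update [CommSemiring R] (r : ℕ) (a y : ι → R) (i : ι) :
    ∃ P Q S : R, ∀ α η : R,
      curvatureNumerator r (Function.update a i α) (Function.update y i η) =
        P + α * Q + η * S := by
  have summand_affine (s : Finset ι) : ∃ P Q S : R, ∀ α η : R,
      (∏ k ∈ s, Function.update a i α k) * (1 + ∑ j ∈ sᶜ, Function.update y i η j) =
        P + α * Q + η * S := by
    by_cases hi : i ∈ s
    · refine ⟨0, (∏ k ∈ s \ {i}, a k) * (1 + ∑ j ∈ sᶜ, y j), 0, fun α η => ?_⟩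
      rw [prod_update_of_mem hi, sum_update_of_notMem (by simpa using hi)]
      ring
    · refine ⟨(∏ k ∈ s, a k) * (1 + ∑ j ∈ sᶜ \ {i}, y j), 0, ∏ k ∈ s, a k, fun α η => ?_⟩
      rw [prod_update_of_notMem hi, sum_update_of_mem (by simpa using hi)]
      ring
  choose P Q S h using summand_affine
  refine ⟨∑ s ∈ univ.powersetCard r, P s, ∑ s ∈ univ.powersetCard r, Q s,
    ∑ s ∈ univ.powersetCard r, S s, fun α η => ?_⟩
  simp only [curvatureNumerator, h, mul_sum, sum_add_distrib]

theorem exists_card_eq_of_curvatureNumerator_ne_zero [CommSemiring R] {r : ℕ} {a y : ι → R}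
    (h : curvatureNumerator r a y ≠ 0) : ∃ s : Finset ι, #s = r ∧ ∀ i ∈ s, a i ≠ 0 := by
  obtain ⟨s, hs, hne⟩ := exists_ne_zero_of_sum_ne_zero h
  exact ⟨s, (mem_powersetCard.1 hs).2,
    fun i hi ha => left_ne_zero_of_mul hne (prod_eq_zero hi ha)⟩

theorem det_submatrix_one_add_vecMulVec_mul_diagonal [CommRing R] (v w a : ι → R)
    (s : Finset ι) :
    (((1 + Matrix.vecMulVec v w) * Matrix.diagonal a).submatrix
      (Subtype.val : s → ι) (Subtype.val : s → ι)).det =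
        (∏ i ∈ s, a i) * (1 + ∑ i ∈ s, w i * v i) := by
  have hfac : ((1 + Matrix.vecMulVec v w) * Matrix.diagonal a).submatrix
      (Subtype.val : s → ι) (Subtype.val : s → ι) =
        (1 + Matrix.replicateCol Unit (fun i : s => v i) *
          Matrix.replicateRow Unit (fun i : s => w i)) * Matrix.diagonal (fun i : s => a i) := by
    ext i j
    rw [Matrix.submatrix_apply, Matrix.mul_diagonal, Matrix.mul_diagonal]
    simp [Matrix.one_apply, Matrix.vecMulVec_apply, Matrix.mul_apply]
  rw [hfac, Matrix.det_mul, Matrix.det_one_add_replicateCol_mul_replicateRow, Matrix.det_diagonal,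
    prod_coe_sort s a, dotProduct, sum_coe_sort s fun i => w i * v i, mul_comm]

theorem charpoly_coeff_rank_one_perturbation_mul_diagonal {K : Type*} [Field K] {r : ℕ}
    (hr : r ≤ Fintype.card ι) (t : K) (u a : ι → K) (hW : 1 + ∑ i, u i ^ 2 ≠ 0) :
    (-1) ^ r * ((1 + Matrix.vecMulVec (-(1 + ∑ i, u i ^ 2)⁻¹ • u) u) *
      Matrix.diagonal (t • a)).charpoly.coeff (Fintype.card ι - r) =
        t ^ r * curvatureNumerator r a (fun i => u i ^ 2) / (1 + ∑ i, u i ^ 2) := by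
  set W := 1 + ∑ i, u i ^ 2
  rw [Matrix.charpoly_coeff_eq_sum_minors _ r hr, ← mul_assoc, ← mul_pow, neg_one_mul, neg_neg,
    one_pow, one_mul, curvatureNumerator, mul_sum, sum_div]
  refine sum_congr rfl fun s hs => ?_
  have hminor : 1 + ∑ i ∈ s, u i * (-W⁻¹ • u) i = (1 + ∑ i ∈ sᶜ, u i ^ 2) / W := by
    have hsplit : W = 1 + (∑ i ∈ s, u i ^ 2 + ∑ i ∈ sᶜ, u i ^ 2) := by rw [sum_add_sum_compl]
    have hsum : ∑ i ∈ s, u i * (-W⁻¹ • u) i = -W⁻¹ * ∑ i ∈ s, u i ^ 2 := by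
      rw [mul_sum]
      exact sum_congr rfl fun i _ => by rw [Pi.smul_apply, smul_eq_mul]; ring
    rw [hsum, eq_div_iff hW]
    linear_combination hsplit - (∑ i ∈ s, u i ^ 2) * inv_mul_cancel₀ hW
  rw [det_submatrix_one_add_vecMulVec_mul_diagonal, hminor]
  simp only [Pi.smul_apply, smul_eq_mul, prod_mul_distrib, prod_const, (mem_powersetCard.1 hs).2]
  ring

end CurvatureNumerator

section RpowTranslates

variable {T₁ T₂ y₀ m : ℝ}

theorem rpow_translates_deriv_eventuallyEq {α β : ℝ} {φ : ℝ → ℝ} (h₁ : 0 < y₀ + T₁)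
    (h₂ : 0 < y₀ + T₂) (h : (fun y => α * (y + T₁) ^ m + β * (y + T₂) ^ m) =ᶠ[𝓝 y₀] φ) :
    (fun y => α * m * (y + T₁) ^ (m - 1) + β * m * (y + T₂) ^ (m - 1)) =ᶠ[𝓝 y₀] deriv φ := by
  have hpos (T : ℝ) (hT : 0 < y₀ + T) : ∀ᶠ y in 𝓝 y₀, 0 < y + T :=
    (continuousAt_id.add continuousAt_const).eventually_const_lt hT
  have hderiv (T y γ : ℝ) (hy : 0 < y + T) :
      HasDerivAt (fun y => γ * (y + T) ^ m) (γ * m * (y + T) ^ (m - 1)) y :=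
    ((((hasDerivAt_id' y).add_const T).rpow_const (p := m) (Or.inl hy.ne')).const_mul
      γ).congr_deriv (by ring)
  filter_upwards [h.deriv, hpos T₁ h₁, hpos T₂ h₂] with y hy hy₁ hy₂
  rw [← hy, ((hderiv T₁ y α hy₁).fun_add (hderiv T₂ y β hy₂)).deriv]

theorem rpow_translates_independent {α β : ℝ} (hm : m ≠ 0) (hT : T₁ ≠ T₂) (h₁ : 0 < y₀ + T₁)
    (h₂ : 0 < y₀ + T₂)
    (h : (fun y => α * (y + T₁) ^ m + β * (y + T₂) ^ m) =ᶠ[𝓝 y₀] fun _ => 0) :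
    α = 0 ∧ β = 0 := by
  have value : α * (y₀ + T₁) ^ m + β * (y₀ + T₂) ^ m = 0 := h.self_of_nhds
  have slope := (rpow_translates_deriv_eventuallyEq h₁ h₂ h).self_of_nhds
  rw [deriv_const] at slope
  rw [← sub_add_cancel m 1, Real.rpow_add_one h₁.ne', Real.rpow_add_one h₂.ne'] at value
  have p₁ := (Real.rpow_pos_of_pos h₁ (m - 1)).ne'
  have p₂ := (Real.rpow_pos_of_pos h₂ (m - 1)).ne'
  have hα : α * (m * (y₀ + T₁) ^ (m - 1) * (T₁ - T₂)) = 0 := by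
    linear_combination m * value - (y₀ + T₂) * slope
  have hβ : β * (m * (y₀ + T₂) ^ (m - 1) * (T₂ - T₁)) = 0 := by
    linear_combination m * value - (y₀ + T₁) * slope
  simpa [hm, p₁, p₂, sub_ne_zero.2 hT, sub_ne_zero.2 hT.symm] using And.intro hα hβ

theorem rpow_translates_independent_mod_affine {α β p q : ℝ} (hm : m ∉ ({0, 1, 2} : Set ℝ))
    (hT : T₁ ≠ T₂) (h₁ : 0 < y₀ + T₁) (h₂ : 0 < y₀ + T₂)
    (h : (fun y => α * (y + T₁) ^ m + β * (y + T₂) ^ m) =ᶠ[𝓝 y₀] fun y => p + q * y) :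
    α = 0 ∧ β = 0 := by
  simp only [Set.mem_insert_iff, Set.mem_singleton_iff, not_or] at hm
  obtain ⟨hm₀, hm₁, hm₂⟩ := hm
  have hm₁' : m - 1 ≠ 0 := sub_ne_zero.2 hm₁
  have hm₂' : m - 1 - 1 ≠ 0 := fun h => hm₂ (by linarith)
  have affine_deriv : deriv (deriv fun y : ℝ => p + q * y) = fun _ => 0 := by
    ext y
    simp
  have hsecond := rpow_translates_deriv_eventuallyEq h₁ h₂
    (rpow_translates_deriv_eventuallyEq h₁ h₂ h)
  rw [affine_deriv] at hsecond
  simpa [hm₀, hm₁'] using rpow_translates_independent hm₂' hT h₁ h₂ hsecond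

theorem eq_zero_of_rpow_translates_eq_affine {X : Type*} {U : Set X} {y a : X → ℝ}
    {c P₁ Q₁ S₁ P₂ Q₂ S₂ : ℝ} (hm : m ∉ ({0, 1, 2} : Set ℝ)) (hT : T₁ ≠ T₂)
    (h₁ : 0 < y₀ + T₁) (h₂ : 0 < y₀ + T₂) (hU : y '' U ∈ 𝓝 y₀)
    (e₁ : ∀ s ∈ U, P₁ + a s * Q₁ + y s * S₁ = c * (y s + T₁) ^ m)
    (e₂ : ∀ s ∈ U, P₂ + a s * Q₂ + y s * S₂ = c * (y s + T₂) ^ m) : c = 0 := by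
  have eliminated : (fun z => c * Q₂ * (z + T₁) ^ m + -(c * Q₁) * (z + T₂) ^ m) =ᶠ[𝓝 y₀]
      fun z => (Q₂ * P₁ - Q₁ * P₂) + (Q₂ * S₁ - Q₁ * S₂) * z := by
    filter_upwards [hU]
    rintro _ ⟨s, hs, rfl⟩
    linear_combination Q₁ * e₂ s hs - Q₂ * e₁ s hs
  by_contra hc
  have hQ₁ : Q₁ = 0 := by
    simpa [hc] using (rpow_translates_independent_mod_affine hm hT h₁ h₂ eliminated).2
  have power_affine : (fun z => c * (z + T₁) ^ m + 0 * (z + T₂) ^ m) =ᶠ[𝓝 y₀]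
      fun z => P₁ + S₁ * z := by
    filter_upwards [hU]
    rintro _ ⟨s, hs, rfl⟩
    linear_combination a s * hQ₁ - e₁ s hs
  exact hc (rpow_translates_independent_mod_affine hm hT h₁ h₂ power_affine).1

end RpowTranslates

section SeparatedEquation

theorem exists_image_sq_mem_nhds {u : ℝ → ℝ} {s₀ : ℝ} (hu : ContDiffAt ℝ 1 u s₀)
    (h₀ : deriv u s₀ ≠ 0) {U : Set ℝ} (hU : U ∈ 𝓝 s₀) :
    ∃ y, (fun s => u s ^ 2) '' U ∈ 𝓝 y := by
  have hcont : ContinuousAt (deriv u) s₀ :=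
    (hu.derivWithin (m := 0) (by simp)).continuousAt
  have hnear : ∀ᶠ s in 𝓝 s₀, ContDiffAt ℝ 1 u s ∧ deriv u s ≠ 0 ∧ U ∈ 𝓝 s :=
    (hu.eventually (by simp)).and ((hcont.eventually_ne h₀).and (eventually_mem_nhds_iff.2 hU))
  have hne : ∀ᶠ s in 𝓝[≠] s₀, u s ≠ 0 :=
    ((hu.differentiableAt one_ne_zero).hasDerivAt).eventually_ne h₀
  obtain ⟨s, ⟨hus, hds, hUs⟩, hs⟩ := ((hnear.filter_mono nhdsWithin_le_nhds).and hne).exists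
  have hsq : HasStrictDerivAt (fun s => u s ^ 2) (2 * u s * deriv u s) s := by
    simpa using (hus.hasStrictDerivAt one_ne_zero).fun_pow 2
  refine ⟨u s ^ 2, ?_⟩
  rw [← hsq.map_nhds_eq (by simp [hs, hds])]
  exact image_mem_map hUs

variable {ι : Type*} [Fintype ι] [DecidableEq ι]

theorem exists_affine_eq_rpow_on_line (r : ℕ) (m c : ℝ) (u : ι → ℝ → ℝ) (x : ι → ℝ) (i : ι) :
    ∃ P Q S : ℝ, ∀ s : ℝ,
      curvatureNumerator r (fun k => deriv (u k) (Function.update x i s k))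
          (fun k => u k (Function.update x i s k) ^ 2) =
        c * (1 + ∑ k, u k (Function.update x i s k) ^ 2) ^ m →
      P + deriv (u i) s * Q + u i s ^ 2 * S =
        c * (u i s ^ 2 + (1 + ∑ k ∈ univ \ {i}, u k (x k) ^ 2)) ^ m := by
  obtain ⟨P, Q, S, h⟩ := exists_affine_curvatureNumerator_update r
    (fun k => deriv (u k) (x k)) (fun k => u k (x k) ^ 2) i
  refine ⟨P, Q, S, fun s hs => ?_⟩
  simp only [Function.apply_update (fun k s => deriv (u k) s) _ i,
    Function.apply_update (fun k s => u k s ^ 2) _ i, sum_update_of_mem (mem_univ i), h] at hs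
  rw [hs, add_left_comm]

theorem eq_zero_of_curvatureNumerator_eq_rpow {r : ℕ} (hr : 2 ≤ r) {m c : ℝ}
    (hm : m ∉ ({0, 1, 2} : Set ℝ)) {u : ι → ℝ → ℝ} {x₀ : ι → ℝ}
    (hu : ∀ i, ContDiffAt ℝ 1 (u i) (x₀ i))
    (heq : ∀ᶠ x in 𝓝 x₀, curvatureNumerator r (fun i => deriv (u i) (x i))
      (fun i => u i (x i) ^ 2) = c * (1 + ∑ i, u i (x i) ^ 2) ^ m) : c = 0 := by
  by_contra hc
  have hne : curvatureNumerator r (fun i => deriv (u i) (x₀ i)) (fun i => u i (x₀ i) ^ 2) ≠ 0 := by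
    rw [heq.self_of_nhds]
    exact mul_ne_zero hc (Real.rpow_pos_of_pos (by positivity) _).ne'
  obtain ⟨t, ht, hdt⟩ := exists_card_eq_of_curvatureNumerator_ne_zero hne
  obtain ⟨i, hi, j, hj, hij⟩ := one_lt_card.1 (ht ▸ hr : 1 < #t)
  let z (q : ℝ × ℝ) : ι → ℝ := Function.update (Function.update x₀ j q.2) i q.1
  have hz : Continuous z :=
    ((continuous_const (y := x₀)).update j continuous_snd).update i continuous_fst
  have hz₀ : z (x₀ i, x₀ j) = x₀ := by simp [z]
  have hev := (hz.tendsto' _ _ hz₀).eventually heq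
  obtain ⟨U, hU, V, hV, hUV⟩ := mem_nhds_prod_iff.1 hev
  obtain ⟨y₀, hy₀⟩ := exists_image_sq_mem_nhds (hu i) (hdt i hi) hU
  obtain ⟨_, hy₁⟩ := exists_image_sq_mem_nhds (hu j) (hdt j hj) hV
  obtain ⟨_, ⟨τ₁, hτ₁, rfl⟩, _, ⟨τ₂, hτ₂, rfl⟩, hτ⟩ := (infinite_of_mem_nhds _ hy₁).nontrivial
  let T (τ : ℝ) : ℝ := 1 + ∑ k ∈ univ \ {i}, u k (Function.update x₀ j τ k) ^ 2
  have hrow (τ : ℝ) (hτ : τ ∈ V) : ∃ P Q S : ℝ, ∀ s ∈ U,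
      P + deriv (u i) s * Q + u i s ^ 2 * S = c * (u i s ^ 2 + T τ) ^ m := by
    obtain ⟨P, Q, S, h⟩ := exists_affine_eq_rpow_on_line r m c u (Function.update x₀ j τ) i
    refine ⟨P, Q, S, fun s hs => h s ?_⟩
    simpa only [Set.mem_ofPred_eq] using hUV (Set.mk_mem_prod hs hτ)
  have hT : T τ₁ ≠ T τ₂ := by
    have hmem : j ∈ univ \ {i} := by simpa using hij.symm
    simpa [T, Function.apply_update (fun k s => u k s ^ 2) _ j, sum_update_of_mem hmem] using hτ
  have hpos (τ : ℝ) : 0 < y₀ + T τ := by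
    obtain ⟨s, -, rfl⟩ := mem_of_mem_nhds hy₀
    positivity
  obtain ⟨P₁, Q₁, S₁, e₁⟩ := hrow τ₁ hτ₁
  obtain ⟨P₂, Q₂, S₂, e₂⟩ := hrow τ₂ hτ₂
  exact hc (eq_zero_of_rpow_translates_eq_affine hm hT (hpos τ₁) (hpos τ₂) hy₀ e₁ e₂)

end SeparatedEquation

section Graph

variable {n : ℕ} {Ω : Set (Euc n)} {F : Euc n → ℝ} {g : Euc n → Euc n} {N : Euc n → Euc (n + 1)}
  {x : Euc n}

theorem fderiv_euclidean_apply {E : Type*} [NormedAddCommGroup E] [NormedSpace ℝ E] {m : ℕ}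
    {G : E → Euc m} {p : E} (hG : DifferentiableAt ℝ G p) (v : E) (i : Fin m) :
    fderiv ℝ G p v i = fderiv ℝ (fun y => G y i) p v :=
  (DFunLike.congr_fun ((EuclideanSpace.proj i : Euc m →L[ℝ] ℝ).hasFDerivAt.comp p
    hG.hasFDerivAt).fderiv v).symm

theorem fderiv_graphMap (hF : DifferentiableAt ℝ F x) (v : Euc n) :
    fderiv ℝ (graphMap F) x v = graphMap (fderiv ℝ F x) v := by
  have hcoord (i : Fin n) : HasFDerivAt (fun y : Euc n => y i)
      (EuclideanSpace.proj i : Euc n →L[ℝ] ℝ) x :=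
    (EuclideanSpace.proj i : Euc n →L[ℝ] ℝ).hasFDerivAt
  have hdiff : DifferentiableAt ℝ (graphMap F) x := by
    refine differentiableAt_euclidean.2 (Fin.lastCases ?_ fun i => ?_)
    · simpa [graphMap] using hF
    · simpa [graphMap] using (hcoord i).differentiableAt
  ext k
  rw [fderiv_euclidean_apply hdiff]
  refine Fin.lastCases ?_ (fun i => ?_) k
  · simp [graphMap]
  · simp [graphMap, (hcoord i).fderiv]

theorem fderiv_graphMap_injective (hF : DifferentiableAt ℝ F x) :
    Function.Injective (fderiv ℝ (graphMap F) x) := by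
  intro v w h
  ext i
  simpa [fderiv_graphMap hF, graphMap] using congrArg (fun z : Euc (n + 1) => z i.castSucc) h

theorem IsUnitNormalField.differentiableAt {ψ : Euc n → Euc (n + 1)} (hΩ : IsOpen Ω)
    (hN : IsUnitNormalField Ω ψ N) (hx : x ∈ Ω) : DifferentiableAt ℝ N x :=
  (hN.smooth.contDiffAt (hΩ.mem_nhds hx)).differentiableAt (by simp)

theorem IsUnitNormalField.apply_castSucc (hN : IsUnitNormalField Ω (graphMap F) N) (hx : x ∈ Ω)
    (hF : HasGradientAt F (g x) x) (i : Fin n) :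
    N x i.castSucc = -(g x i * N x (Fin.last n)) := by
  have h := hN.normal x hx (EuclideanSpace.single i 1)
  rw [fderiv_graphMap hF.differentiableAt, PiLp.inner_apply, Fin.sum_univ_castSucc] at h
  simp only [graphMap, Fin.snoc_castSucc, Fin.snoc_last, hF.fderiv_apply,
    EuclideanSpace.inner_single_right, PiLp.single_apply, RCLike.inner_apply, Real.ringHom_apply,
    one_mul, ite_mul, zero_mul, sum_ite_eq', mem_univ, if_true] at h
  linarith

theorem IsUnitNormalField.sq_apply_last (hN : IsUnitNormalField Ω (graphMap F) N) (hx : x ∈ Ω)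
    (hF : HasGradientAt F (g x) x) : N x (Fin.last n) ^ 2 * (1 + ‖g x‖ ^ 2) = 1 := by
  have h : ‖N x‖ ^ 2 = 1 := by rw [hN.norm_eq_one x hx, one_pow]
  rw [EuclideanSpace.real_norm_sq_eq, Fin.sum_univ_castSucc] at h
  simp only [hN.apply_castSucc hx hF, neg_sq, mul_pow, ← sum_mul] at h
  rw [EuclideanSpace.real_norm_sq_eq]
  linarith

theorem IsUnitNormalField.eventually_apply_last_eq (hΩ : IsOpen Ω)
    (hN : IsUnitNormalField Ω (graphMap F) N) (hF : ∀ y ∈ Ω, HasGradientAt F (g y) y)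
    (hx : x ∈ Ω) : ∃ ε : ℝ, ε ≠ 0 ∧
      ∀ᶠ y in 𝓝 x, N y (Fin.last n) = ε / √(1 + ‖g y‖ ^ 2) := by
  have hcont : ContinuousAt (fun y => N y (Fin.last n)) x :=
    (differentiableAt_euclidean.1 (hN.differentiableAt hΩ hx) _).continuousAt
  have hne : N x (Fin.last n) ≠ 0 := fun h => by simpa [h] using hN.sq_apply_last hx (hF x hx)
  have hsign : ∀ᶠ y in 𝓝 x, SignType.sign (N y (Fin.last n)) = SignType.sign (N x (Fin.last n)) :=
    ((continuousAt_sign_of_ne_zero hne).comp (f := fun y => N y (Fin.last n)) hcont).eventually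
      (mem_nhds_discrete.2 (Set.mem_singleton _))
  refine ⟨SignType.sign (N x (Fin.last n)),
    fun h => hne (by rw [← sign_mul_abs (N x (Fin.last n)), h, zero_mul]), ?_⟩
  filter_upwards [hΩ.mem_nhds hx, hsign] with y hy hsy
  have habs : |N y (Fin.last n)| * √(1 + ‖g y‖ ^ 2) = 1 := by
    rw [← Real.sqrt_sq_eq_abs, ← Real.sqrt_mul (sq_nonneg _), hN.sq_apply_last hy (hF y hy),
      Real.sqrt_one]
  have hW : √(1 + ‖g y‖ ^ 2) ≠ 0 := right_ne_zero_of_mul_eq_one habs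
  rw [← hsy, eq_div_iff hW]
  calc N y (Fin.last n) * √(1 + ‖g y‖ ^ 2)
      = SignType.sign (N y (Fin.last n)) * (|N y (Fin.last n)| * √(1 + ‖g y‖ ^ 2)) := by
        rw [← mul_assoc, sign_mul_abs]
    _ = SignType.sign (N y (Fin.last n)) := by rw [habs, mul_one]

theorem IsUnitNormalField.shapeOperator_apply (hΩ : IsOpen Ω)
    (hN : IsUnitNormalField Ω (graphMap F) N) (hF : ∀ y ∈ Ω, HasGradientAt F (g y) y)
    (hx : x ∈ Ω) (hg : DifferentiableAt ℝ g x) (v : Euc n) :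
    shapeOperator (graphMap F) N x v =
      N x (Fin.last n) • (fderiv ℝ g x v - (⟪g x, fderiv ℝ g x v⟫ / (1 + ‖g x‖ ^ 2)) • g x) := by
  have hFx := hF x hx
  have hNd := hN.differentiableAt hΩ hx
  set t := N x (Fin.last n) with ht
  set τ := fderiv ℝ (fun y => N y (Fin.last n)) x v with hτ
  set w := shapeOperator (graphMap F) N x v
  have hspec : graphMap (fderiv ℝ F x) w = -fderiv ℝ N x v := by
    rw [← fderiv_graphMap hFx.differentiableAt]
    exact shapeOperator_spec hΩ hN hx (fderiv_graphMap_injective hFx.differentiableAt) v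
  have tangential : w = τ • g x + t • fderiv ℝ g x v := by
    ext k
    have hNk : (fun y => N y k.castSucc) =ᶠ[𝓝 x] fun y => -(g y k * N y (Fin.last n)) := by
      filter_upwards [hΩ.mem_nhds hx] with y hy using hN.apply_castSucc hy (hF y hy) k
    have hderiv := ((differentiableAt_euclidean.1 hg k).hasFDerivAt.mul
      (differentiableAt_euclidean.1 hNd (Fin.last n)).hasFDerivAt).neg.congr_of_eventuallyEq hNk
    have hk := congrArg (fun z : Euc (n + 1) => z k.castSucc) hspec
    simp only [PiLp.neg_apply, fderiv_euclidean_apply hNd, hderiv.fderiv] at hk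
    simp only [graphMap, Fin.snoc_castSucc, neg_apply, add_apply, smul_apply, smul_eq_mul,
      ← fderiv_euclidean_apply hg, ← hτ, ← ht] at hk
    rw [PiLp.add_apply, PiLp.smul_apply, PiLp.smul_apply, smul_eq_mul, smul_eq_mul]
    linear_combination hk
  have vertical : ⟪g x, w⟫ = -τ := by
    have hlast := congrArg (fun z : Euc (n + 1) => z (Fin.last n)) hspec
    simpa [graphMap, hFx.fderiv_apply, fderiv_euclidean_apply hNd] using hlast
  have hτ_eq : τ = -(t * (⟪g x, fderiv ℝ g x v⟫ / (1 + ‖g x‖ ^ 2))) := by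
    rw [tangential, inner_add_right, inner_smul_right, inner_smul_right,
      real_inner_self_eq_norm_sq] at vertical
    have hW : 1 + ‖g x‖ ^ 2 ≠ 0 := by positivity
    rw [← mul_div_assoc, ← neg_div, eq_div_iff hW]
    linarith
  rw [tangential, hτ_eq]
  module

end Graph

section TranslationGraph

variable {n : ℕ} {Ω : Set (Euc n)} {f : Fin n → ℝ → ℝ} {N : Euc n → Euc (n + 1)} {x : Euc n}

/-- The gradient `(f₁'(x₁), …, fₙ'(xₙ))` of `separableSum f`, as a vector field on Euclidean
space. -/
noncomputable def separableGradient (f : Fin n → ℝ → ℝ) (x : Euc n) : Euc n :=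
  WithLp.toLp 2 fun i => deriv (f i) (x i)

theorem separableGradient_apply (f : Fin n → ℝ → ℝ) (x : Euc n) (i : Fin n) :
    separableGradient f x i = deriv (f i) (x i) :=
  rfl

theorem norm_separableGradient_sq (f : Fin n → ℝ → ℝ) (x : Euc n) :
    ‖separableGradient f x‖ ^ 2 = ∑ i, deriv (f i) (x i) ^ 2 :=
  EuclideanSpace.real_norm_sq_eq _

theorem hasFDerivAt_comp_coord {h : ℝ → ℝ} {i : Fin n} (hh : DifferentiableAt ℝ h (x i)) :
    HasFDerivAt (fun y : Euc n => h (y i))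
      (deriv h (x i) • (EuclideanSpace.proj i : Euc n →L[ℝ] ℝ)) x :=
  hh.hasDerivAt.comp_hasFDerivAt x (EuclideanSpace.proj i : Euc n →L[ℝ] ℝ).hasFDerivAt

theorem hasGradientAt_separableSum (hf : ∀ i, DifferentiableAt ℝ (f i) (x i)) :
    HasGradientAt (separableSum f) (separableGradient f x) x := by
  rw [hasGradientAt_iff_hasFDerivAt]
  refine (HasFDerivAt.fun_sum (u := univ) fun i _ => hasFDerivAt_comp_coord (hf i)).congr_fderiv ?_
  ext v
  simp [separableGradient, PiLp.inner_apply, mul_comm]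

theorem differentiableAt_separableGradient
    (hf : ∀ i, DifferentiableAt ℝ (deriv (f i)) (x i)) :
    DifferentiableAt ℝ (separableGradient f) x :=
  differentiableAt_euclidean.2 fun i => (hasFDerivAt_comp_coord (hf i)).differentiableAt

theorem fderiv_separableGradient_apply (hf : ∀ i, DifferentiableAt ℝ (deriv (f i)) (x i))
    (v : Euc n) (i : Fin n) :
    fderiv ℝ (separableGradient f) x v i = deriv (deriv (f i)) (x i) * v i := by
  rw [fderiv_euclidean_apply (differentiableAt_separableGradient hf)]
  exact DFunLike.congr_fun (hasFDerivAt_comp_coord (hf i)).fderiv v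

theorem IsTranslationGraph.contDiffAt (hM : IsTranslationGraph Ω f) (hx : x ∈ Ω) (i : Fin n) :
    ContDiffAt ℝ ∞ (f i) (x i) := by
  have hopen : IsOpenMap fun y : Euc n => y i :=
    (EuclideanSpace.proj i : Euc n →L[ℝ] ℝ).isOpenMap fun c => ⟨EuclideanSpace.single i c, by simp⟩
  exact (hM.smooth i).contDiffAt ((hopen Ω hM.isOpen).mem_nhds ⟨x, hx, rfl⟩)

theorem IsTranslationGraph.contDiffAt_deriv (hM : IsTranslationGraph Ω f) (hx : x ∈ Ω)
    (i : Fin n) : ContDiffAt ℝ 1 (deriv (f i)) (x i) :=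
  (hM.contDiffAt hx i).derivWithin (m := 1) (by norm_cast)

theorem IsTranslationGraph.hasGradientAt (hM : IsTranslationGraph Ω f) (hx : x ∈ Ω) :
    HasGradientAt (separableSum f) (separableGradient f x) x :=
  hasGradientAt_separableSum fun i => (hM.contDiffAt hx i).differentiableAt (by simp)

theorem toMatrix_shapeOperator_separableSum (hM : IsTranslationGraph Ω f)
    (hN : IsUnitNormalField Ω (graphMap (separableSum f)) N) (hx : x ∈ Ω) :
    LinearMap.toMatrix (EuclideanSpace.basisFun (Fin n) ℝ).toBasis
      (EuclideanSpace.basisFun (Fin n) ℝ).toBasis (shapeOperator (graphMap (separableSum f)) N x) =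
      (1 + Matrix.vecMulVec (-(1 + ∑ i, deriv (f i) (x i) ^ 2)⁻¹ • fun i => deriv (f i) (x i))
        fun i => deriv (f i) (x i)) *
          Matrix.diagonal (N x (Fin.last n) • fun i => deriv (deriv (f i)) (x i)) := by
  have hf₂ (i : Fin n) := (hM.contDiffAt_deriv hx i).differentiableAt one_ne_zero
  ext i j
  rw [LinearMap.toMatrix_apply, Matrix.mul_diagonal, Matrix.add_apply, Matrix.vecMulVec_apply,
    OrthonormalBasis.coe_toBasis, EuclideanSpace.basisFun_apply,
    hN.shapeOperator_apply hM.isOpen (fun y hy => hM.hasGradientAt hy) hx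
      (differentiableAt_separableGradient hf₂)]
  have hinner : ⟪separableGradient f x, fderiv ℝ (separableGradient f) x
      (EuclideanSpace.single j 1)⟫ = deriv (f j) (x j) * deriv (deriv (f j)) (x j) := by
    rw [PiLp.inner_apply]
    simp [fderiv_separableGradient_apply hf₂, separableGradient_apply, mul_comm]
  rw [hinner, norm_separableGradient_sq, OrthonormalBasis.coe_toBasis_repr_apply,
    EuclideanSpace.basisFun_repr, PiLp.smul_apply, PiLp.sub_apply, PiLp.smul_apply,
    fderiv_separableGradient_apply hf₂, separableGradient_apply, PiLp.single_apply,
    Matrix.one_apply]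
  simp only [Pi.smul_apply, smul_eq_mul]
  split_ifs with hij
  · rw [hij]
    ring
  · ring

theorem Scurv_separableSum (hM : IsTranslationGraph Ω f)
    (hN : IsUnitNormalField Ω (graphMap (separableSum f)) N) {r : ℕ} (hr : r ≤ n) (hx : x ∈ Ω) :
    Scurv r (graphMap (separableSum f)) N x =
      N x (Fin.last n) ^ r * curvatureNumerator r (fun i => deriv (deriv (f i)) (x i))
        (fun i => deriv (f i) (x i) ^ 2) / (1 + ∑ i, deriv (f i) (x i) ^ 2) := by
  have hcoeff := charpoly_coeff_rank_one_perturbation_mul_diagonal (r := r) (by simpa using hr)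
    (N x (Fin.last n)) (fun i => deriv (f i) (x i)) (fun i => deriv (deriv (f i)) (x i))
    (by positivity)
  rw [Fintype.card_fin] at hcoeff
  rw [Scurv, ← LinearMap.charpoly_toMatrix _ (EuclideanSpace.basisFun (Fin n) ℝ).toBasis,
    toMatrix_shapeOperator_separableSum hM hN hx, hcoeff]

theorem exists_eventually_curvatureNumerator_eq (hM : IsTranslationGraph Ω f)
    (hN : IsUnitNormalField Ω (graphMap (separableSum f)) N) {r : ℕ} (hr : r ≤ n) (hx : x ∈ Ω) :
    ∃ ε : ℝ, ε ≠ 0 ∧ ∀ᶠ y in 𝓝 x,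
      curvatureNumerator r (fun i => deriv (deriv (f i)) (y i)) (fun i => deriv (f i) (y i) ^ 2) =
        ε * Scurv r (graphMap (separableSum f)) N y *
          (1 + ∑ i, deriv (f i) (y i) ^ 2) ^ (((r : ℝ) + 2) / 2) := by
  obtain ⟨ε, hε, hlast⟩ :=
    hN.eventually_apply_last_eq hM.isOpen (fun y hy => hM.hasGradientAt hy) hx
  refine ⟨(ε ^ r)⁻¹, inv_ne_zero (pow_ne_zero r hε), ?_⟩
  filter_upwards [hlast, hM.isOpen.mem_nhds hx] with y hlast hy
  rw [norm_separableGradient_sq] at hlast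
  rw [Scurv_separableSum hM hN hr hy, hlast, div_pow]
  set W := 1 + ∑ i, deriv (f i) (y i) ^ 2
  have hW : 0 < W := by positivity
  have hpow : W ^ (((r : ℝ) + 2) / 2) = √W ^ r * W := by
    rw [Real.sqrt_eq_rpow, ← Real.rpow_mul_natCast hW.le, ← Real.rpow_add_one hW.ne']
    congr 1
    ring
  rw [hpow]
  field_simp

end TranslationGraph

end TranslationHypersurface

open TranslationHypersurface in
theorem theorem2_general (n r : ℕ) (hr : 2 < r) (hrn : r ≤ n) (Ω : Set (Euc n))
    (f : Fin n → ℝ → ℝ) (hM : IsTranslationGraph Ω f) (N : Euc n → Euc (n + 1))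
    (hN : IsUnitNormalField Ω (graphMap (separableSum f)) N)
    (hconst : ∃ c : ℝ, ∀ x ∈ Ω, Scurv r (graphMap (separableSum f)) N x = c) :
    ∀ x ∈ Ω, Scurv r (graphMap (separableSum f)) N x = 0 := by
  obtain ⟨c, hc⟩ := hconst
  intro x hx
  have hr' : (2 : ℝ) < r := by exact_mod_cast hr
  have hm : ((r : ℝ) + 2) / 2 ∉ ({0, 1, 2} : Set ℝ) := by
    rintro (h | h | (h : _ = (2 : ℝ))) <;> linarith
  obtain ⟨ε, hε, hev⟩ := exists_eventually_curvatureNumerator_eq hM hN hrn hx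
  have hnumerator : ∀ᶠ y in 𝓝 x.ofLp,
      curvatureNumerator r (fun i => deriv (deriv (f i)) (y i)) (fun i => deriv (f i) (y i) ^ 2) =
        ε * c * (1 + ∑ i, deriv (f i) (y i) ^ 2) ^ (((r : ℝ) + 2) / 2) := by
    have hconst_near := hev.and (hM.isOpen.mem_nhds hx)
    filter_upwards [((PiLp.continuous_toLp 2 _).tendsto x.ofLp).eventually hconst_near]
      with y ⟨hy, hyΩ⟩
    simpa only [hc _ hyΩ] using hy
  have hεc := eq_zero_of_curvatureNumerator_eq_rpow hr.le hm (hM.contDiffAt_deriv hx) hnumerator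
  rw [hc x hx, (mul_eq_zero.1 hεc).resolve_left hε]

theorem theorem2 (n r : ℕ) (hn : 3 ≤ n) (hr : 2 < r) (hrn : r < n)
    (Ω : Set (TranslationHypersurface.Euc n)) (f : Fin n → ℝ → ℝ)
    (hM : TranslationHypersurface.IsTranslationGraph Ω f)
    (N : TranslationHypersurface.Euc n → TranslationHypersurface.Euc (n + 1))
    (hN : TranslationHypersurface.IsUnitNormalField Ω
      (TranslationHypersurface.graphMap (TranslationHypersurface.separableSum f)) N)
    (hconst : ∃ c : ℝ, ∀ x ∈ Ω,
      TranslationHypersurface.Scurv r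
        (TranslationHypersurface.graphMap (TranslationHypersurface.separableSum f)) N x = c) :
    ∀ x ∈ Ω,
      TranslationHypersurface.Scurv r
        (TranslationHypersurface.graphMap (TranslationHypersurface.separableSum f)) N x = 0 :=
  theorem2_general n r hr hrn.le Ω f hM N hN hconst
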